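/- Let $\mathbb K=\mathbb R$ or $\mathbb C$, let $X_1,\dots,X_m,Y$ be Banach spaces over $\mathbb K$, let $2\le q<\infty$, and suppose that $Y$ has cotype $q$, i.e. there is $C>0$ with $$\Big(\sum_{k=1}^{l}\|y_k\|^q\Big)^{1/q}\le C\Big(\int_0^1\Big\|\sum_{k=1}^{l} r_k(t)\,y_k\Big\|^2dt\Big)^{1/2}$$ for all finite families $y_1,\dots,y_l\in Y$, where $r_k(t)=\operatorname{sign}\sin(2^k\pi t)$ are the Rademacher functions; let $C_q(Y)$ be the infimum of such $C$. For $r\ge 1$ let $\mathrm K_{r,2}$ be the infimum of the $K>0$ such that $$\Big(\int_0^1\Big\|\sum_k r_k(t)x_k\Big\|^2dt\Big)^{1/2}\le K\Big(\int_0^1\Big\|\sum_k r_k(t)x_k\Big\|^rdt\Big)^{1/r}$$ for all finite families in all Banach spaces over $\mathbb K$, and put $\mathrm A_{q,r}(Y):=C_q(Y)\,\mathrm K_{r,2}$. For a nonempty finite index set $D$, Banach spaces $X_k$ $(k\in D)$ and $1\le s<\infty$, a bounded $|D|$-linear operator $V:\prod_{k\in D}X_k\to Y$ is multiple $(s,1)$-summing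 if there is $C>0$ such that $$\Big(\sum_{\mathbf i\in\{1,\dots,M\}^{D}}\big\|V\big((x^{(k)}_{i_k})_{k\in D}\big)\big\|^s\Big)^{1/s}\le C\prod_{k\in D}\sup_{\|\varphi\|_{X_k'}\le1}\sum_{i=1}^{M}|\varphi(x^{(k)}_i)|$$ for all $M$ and all $x^{(k)}_i\in X_k$; the infimum of such $C$ is $\pi^{|D|}_{(s,1)}(V)$, a norm on the space $\Pi^{|D|}_{(s,1)}(X^D;Y)$ of these operators, where $X^D:=\prod_{k\in D}X_k$. If $V$ is a bounded multilinear operator on $X^D$ and $S\subseteq D$, then for $z\in X^{D\setminus S}$ let $V^S_z:X^S\to Y$ be the multilinear operator obtained from $V$ by fixing the coordinates outside $S$ through $z$, and let $V^S:z\mapsto V^S_z$. The operator $V$ is multiple $(s,1)$-summing in $S$ if $V^S_z\in\Pi^{|S|}_{(s,1)}(X^S;Y)$ for all $z$, and $\|V^S:X^{D\setminus S}\to\Pi^{|S|}_{(s,1)}(X^S;Y)\|$ is the infimum of the $C\ge0$ with $\pi^{|S|}_{(s,1)}(V^S_z)\le C\prod_{k\in D\setminus S}\|z_k\|$ for all $z$.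 A bounded $m$-linear $U:X_1\times\cdots\times X_m\to Y$ is $N$-separately $(s,1)$-summing if it is multiple $(s,1)$-summing in every $S\subseteq\{1,\dots,m\}$ with $|S|=N$ (for $N=m$: if it is multiple $(s,1)$-summing). Write $\mathcal P_n(D)$ for the set of $n$-element subsets of $D$, and $\widehat D:=\{1,\dots,m\}\setminus D$. **Theorem.** Let $1\le r\le q$ and $1\le n<m$, and let $U:X_1\times\cdots\times X_m\to Y$ be a bounded $m$-linear operator that is $n$-separately $(r,1)$-summing. Then for every $n<N\le m$, $U$ is $N$-separately $(r_N,1)$-summing, where $$r_N:=\frac{qrN}{nq+(N-n)r}.$$ Moreover, if $N<m$, then for every $D\in\mathcal P_N(\{1,\dots,m\})$ and every $x\in X^{\widehat D}$, $$\pi^N_{(r_N,1)}\big(U^D_x\big)\le \mathrm A_{q,r}(Y)^{N-n}\prod_{S\in\mathcal P_n(D)}\Big\|\big(U^D_x\big)^S:X^{D\setminus S}\to\Pi^n_{(r,1)}(X^S;Y)\Big\|^{1/\binom Nn},$$ and for $N=m$, $$\pi^m_{(r_m,1)}(U)\le \mathrm A_{q,r}(Y)^{m-n}\prod_{S\in\mathcal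 P_n(\{1,\dots,m\})}\Big\|U^S:X^{\widehat S}\to\Pi^n_{(r,1)}(X^S;Y)\Big\|^{1/\binom mn};$$ all the multilinear operators whose norms appear on the right-hand sides are bounded. -/

import Mathlib

universe u v

noncomputable section

namespace MultipleSumming

/-! ### Rademacher averages, cotype, and the Kahane constants -/

/-- The `k`-th Rademacher function `r_k (t) = sign (sin (2 ^ k * π * t))`, for `k = 1, 2, …`. -/
def rademacher (k : ℕ) (t : ℝ) : ℝ :=
  Real.sign (Real.sin (2 ^ k * Real.pi * t))

/-- The Rademacher average `(∫ t in [0, 1], ‖∑ k, r_k (t) x_k‖ ^ p) ^ (1 / p)` of finitely many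
vectors (indexed from `0`, so that `x k` is paired with the function number `k + 1`). -/
def rademacherNorm (𝕜 : Type*) [RCLike 𝕜] {E : Type*} [NormedAddCommGroup E] [NormedSpace 𝕜 E]
    (p : ℝ) {n : ℕ} (x : Fin n → E) : ℝ :=
  (∫ t in (0 : ℝ)..1, ‖∑ k : Fin n, ((rademacher (k + 1) t : ℝ) : 𝕜) • x k‖ ^ p) ^ (1 / p)

/-- `C` is an admissible constant in the cotype `q` inequality of `Y`. -/
def IsCotypeConst (𝕜 : Type*) [RCLike 𝕜] (q : ℝ) (Y : Type*) [NormedAddCommGroup Y]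
    [NormedSpace 𝕜 Y] (C : ℝ) : Prop :=
  0 < C ∧ ∀ (n : ℕ) (x : Fin n → Y),
    (∑ k, ‖x k‖ ^ q) ^ (1 / q) ≤ C * rademacherNorm 𝕜 2 x

/-- `Y` has cotype `q`. -/
def HasCotype (𝕜 : Type*) [RCLike 𝕜] (q : ℝ) (Y : Type*) [NormedAddCommGroup Y]
    [NormedSpace 𝕜 Y] : Prop :=
  ∃ C : ℝ, IsCotypeConst 𝕜 q Y C

/-- The cotype `q` constant `C_q (Y)`. -/
def cotypeConst (𝕜 : Type*) [RCLike 𝕜] (q : ℝ) (Y : Type*) [NormedAddCommGroup Y]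
    [NormedSpace 𝕜 Y] : ℝ :=
  sInf {C : ℝ | IsCotypeConst 𝕜 q Y C}

/-- `K` is an admissible constant in Kahane's inequality between the `L_q` and the `L_p` averages,
simultaneously for all Banach spaces and all finite families of vectors. -/
def IsKahaneConst (𝕜 : Type*) [RCLike 𝕜] (p q K : ℝ) : Prop :=
  0 < K ∧ ∀ (E : Type v) [NormedAddCommGroup E] [NormedSpace 𝕜 E] [CompleteSpace E]
    (n : ℕ) (x : Fin n → E), rademacherNorm 𝕜 q x ≤ K * rademacherNorm 𝕜 p x

/-- The Kahane constant `K_{p,q}` (the best constant). The inequality concerns finitely many vectors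
only, hence finite dimensional spaces, so its value does not depend on the universe `v`. -/
def kahaneConst (𝕜 : Type*) [RCLike 𝕜] (p q : ℝ) : ℝ :=
  sInf {K : ℝ | IsKahaneConst.{v} 𝕜 p q K}

/-- The constant `A_{q,r} (Y) = C_q (Y) * K_{r,2}`. -/
def constA (𝕜 : Type*) [RCLike 𝕜] (q r : ℝ) (Y : Type v) [NormedAddCommGroup Y]
    [NormedSpace 𝕜 Y] : ℝ :=
  cotypeConst 𝕜 q Y * kahaneConst.{v} 𝕜 r 2

/-! ### Multiple summing operators -/

/-- The weak `ℓ_1` norm of finitely many vectors. -/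
def weakL1Norm (𝕜 : Type*) [RCLike 𝕜] {E : Type*} [NormedAddCommGroup E] [NormedSpace 𝕜 E]
    {n : ℕ} (x : Fin n → E) : ℝ :=
  ⨆ φ : {φ : E →L[𝕜] 𝕜 // ‖φ‖ ≤ 1}, ∑ i, ‖φ.1 (x i)‖

section

variable {𝕜 : Type*} [RCLike 𝕜] {ι : Type*} [Fintype ι] [DecidableEq ι]
  {X : ι → Type u} [∀ k, NormedAddCommGroup (X k)] [∀ k, NormedSpace 𝕜 (X k)]
  {Y : Type v} [NormedAddCommGroup Y] [NormedSpace 𝕜 Y]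

/-- `C` is an admissible constant in the definition of a multiple `(r, 1)`-summing operator. -/
def IsSummingConst (r : ℝ) (U : ContinuousMultilinearMap 𝕜 X Y) (C : ℝ) : Prop :=
  0 < C ∧ ∀ (n : ℕ) (x : ∀ k, Fin n → X k),
    (∑ i : ι → Fin n, ‖U (fun k => x k (i k))‖ ^ r) ^ (1 / r) ≤ C * ∏ k, weakL1Norm 𝕜 (x k)

/-- `U` is multiple `(r, 1)`-summing. -/
def IsMultipleSumming (r : ℝ) (U : ContinuousMultilinearMap 𝕜 X Y) : Prop :=
  ∃ C : ℝ, IsSummingConst r U C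

/-- The multiple summing norm `π_{(r,1)} (U)`. -/
def summingNorm (r : ℝ) (U : ContinuousMultilinearMap 𝕜 X Y) : ℝ :=
  sInf {C : ℝ | IsSummingConst r U C}

/-- The operator `U^D_x` in the variables `k ∈ D`: the coordinates outside `D` are fixed
through `x`. -/
def partialMap (U : ContinuousMultilinearMap 𝕜 X Y) (D : Finset ι)
    (x : ∀ k : {k // ¬ k ∈ D}, X k) :
    ContinuousMultilinearMap 𝕜 (fun k : {k // k ∈ D} => X k) Y where
  toMultilinearMap := U.toMultilinearMap.domDomRestrict (fun k => k ∈ D) x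
  cont := by
    change Continuous fun y : (∀ k : {k // k ∈ D}, X k) =>
      U (fun j => if h : j ∈ D then y ⟨j, h⟩ else x ⟨j, h⟩)
    refine U.cont.comp (continuous_pi fun j => ?_)
    by_cases h : j ∈ D
    · simpa [h] using continuous_apply (⟨j, h⟩ : {k // k ∈ D})
    · simpa [h] using continuous_const

/-- `U` is multiple `(r, 1)`-summing in the coordinates of `D`: the map `x ↦ U^D_x` takes its values
in the multiple `(r, 1)`-summing operators. -/
def IsMultipleSummingIn (r : ℝ) (U : ContinuousMultilinearMap 𝕜 X Y) (D : Finset ι) : Prop :=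
  ∀ x : (∀ k : {k // ¬ k ∈ D}, X k), IsMultipleSumming r (partialMap U D x)

/-- `U` is `N`-separately `(r, 1)`-summing. -/
def IsSeparatelySumming (N : ℕ) (r : ℝ) (U : ContinuousMultilinearMap 𝕜 X Y) : Prop :=
  ∀ D : Finset ι, D.card = N → IsMultipleSummingIn r U D

/-- `C` is a bound for the multilinear operator `x ↦ U^D_x`, with values in the space of multiple
`(r, 1)`-summing operators normed by `summingNorm r`. -/
def IsPartialBound (r : ℝ) (U : ContinuousMultilinearMap 𝕜 X Y) (D : Finset ι) (C : ℝ) : Prop :=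
  0 ≤ C ∧ ∀ x : (∀ k : {k // ¬ k ∈ D}, X k), summingNorm r (partialMap U D x) ≤ C * ∏ k, ‖x k‖

/-- The multilinear operator `x ↦ U^D_x` into the multiple `(r, 1)`-summing operators is bounded. -/
def PartialBounded (r : ℝ) (U : ContinuousMultilinearMap 𝕜 X Y) (D : Finset ι) : Prop :=
  ∃ C : ℝ, IsPartialBound r U D C

/-- The norm `‖U^D‖` of the multilinear operator `x ↦ U^D_x` into the multiple `(r, 1)`-summing
operators. -/
def partialNorm (r : ℝ) (U : ContinuousMultilinearMap 𝕜 X Y) (D : Finset ι) : ℝ :=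
  sInf {C : ℝ | IsPartialBound r U D C}

end

end MultipleSumming

end

namespace MultipleSumming

open Finset
open scoped NNReal ENNReal

/-! ### Finite Hölder and Minkowski inequalities -/

/-! Fix finite families of vectors and N coordinates. For each n-subset S, consider the mixed norm
of the array of values of U with exponent r in the coordinates of S and q in the others.
Interpolating these mixed norms with equal weights 1 / binom(N, n) (`mixedNorm_le_prod`) produces
the ℓ_{r_N} norm, because every coordinate lies in the proportion n / N of the sets S
(`sum_powersetCard_div`).

Each mixed norm is bounded one coordinate at a time (`mixedNorm_nnnorm_le`). Outside S, cotype q and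
Kahane's inequality replace an ℓ_q sum by an L_r average over signs at the cost of a factor A; since
r ≤ q, Minkowski's inequality moves the averages past the remaining sums. By multilinearity the
coordinates outside S are then filled with vectors ∑ ± x_i, whose norms are at most the weak ℓ_1
norms, and summability in S finishes the estimate (`randomized_sum_le`).

Two facts make the constants meaningful: Kahane's inequality holds with √2
(`isKahaneConst_sqrt_two`), and z ↦ U^S_z is bounded by a Baire category argument
(`multilinear_banach_steinhaus`). -/

theorem sum_fin_cons {β : Type*} [AddCommMonoid β] {m : ℕ} {κ : Type*} [Fintype κ]
    (f : (Fin (m + 1) → κ) → β) :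
    ∑ j, f j = ∑ i, ∑ j : Fin m → κ, f (Fin.cons i j : Fin (m + 1) → κ) := by
  rw [← Fintype.sum_prod_type', ← (Fin.consEquiv fun _ : Fin (m + 1) => κ).sum_comp]
  rfl

/-- Hölder's inequality with several factors, read off from its integral version for the counting
measure. -/
theorem sum_prod_rpow_le {κ σ : Type*} [Fintype κ] (s : Finset σ) (f : σ → κ → ℝ≥0) (w : σ → ℝ)
    (hw : ∑ S ∈ s, w S = 1) (hw0 : ∀ S ∈ s, 0 ≤ w S) :
    ∑ i, ∏ S ∈ s, f S i ^ w S ≤ ∏ S ∈ s, (∑ i, f S i) ^ w S := by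
  let _ : MeasurableSpace κ := ⊤
  have h := ENNReal.lintegral_prod_norm_pow_le (μ := MeasureTheory.Measure.count) s
    (f := fun S i => (f S i : ℝ≥0∞)) (fun S _ => measurable_from_top.aemeasurable) hw hw0
  simp only [MeasureTheory.lintegral_count, tsum_fintype] at h
  have h1 : ∀ i, ∏ S ∈ s, (f S i : ℝ≥0∞) ^ w S = ((∏ S ∈ s, f S i ^ w S : ℝ≥0) : ℝ≥0∞) := by
    intro i
    rw [ENNReal.ofNNReal_finsetProd]
    exact prod_congr rfl fun S hS => (ENNReal.coe_rpow_of_nonneg _ (hw0 S hS)).symm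
  have h2 : ∏ S ∈ s, (∑ i, (f S i : ℝ≥0∞)) ^ w S
      = ((∏ S ∈ s, (∑ i, f S i) ^ w S : ℝ≥0) : ℝ≥0∞) := by
    rw [ENNReal.ofNNReal_finsetProd]
    refine prod_congr rfl fun S hS => ?_
    rw [ENNReal.coe_rpow_of_nonneg _ (hw0 S hS), ENNReal.ofNNReal_finsetSum]
  rw [h2, sum_congr rfl fun i _ => h1 i, ← ENNReal.ofNNReal_finsetSum] at h
  exact_mod_cast h

theorem nnreal_minkowski_sum {κ τ : Type*} [Fintype κ] (t : Finset τ) (h : κ → τ → ℝ≥0) {s : ℝ}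
    (hs : 1 ≤ s) :
    (∑ i, (∑ ω ∈ t, h i ω) ^ s) ^ (1 / s) ≤ ∑ ω ∈ t, (∑ i, h i ω ^ s) ^ (1 / s) := by
  classical
  have hs0 : s ≠ 0 := by positivity
  induction t using Finset.induction with
  | empty => simp [NNReal.zero_rpow hs0, hs0]
  | insert a t ha ih =>
    simp only [sum_insert ha]
    exact (NNReal.Lp_add_le univ (fun i => h i a) (fun i => ∑ ω ∈ t, h i ω) hs).trans
      (add_le_add_right ih _)

/-- Minkowski's inequality for weighted mixed norms with exponents `r ≤ p`. -/
theorem nnreal_minkowski_mixed {κ τ : Type*} [Fintype κ] [Fintype τ] (W : τ → ℝ≥0)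
    (g : κ → τ → ℝ≥0) {r p : ℝ} (hr : 0 < r) (hp : r ≤ p) :
    (∑ i, ((∑ ω, W ω * g i ω ^ r) ^ (1 / r)) ^ p) ^ (1 / p)
      ≤ (∑ ω, W ω * ((∑ i, g i ω ^ p) ^ (1 / p)) ^ r) ^ (1 / r) := by
  have hp0 : 0 < p := hr.trans_le hp
  -- The triangle inequality in ℓ_{p/r}, applied to the r-th powers; this needs r ≤ p.
  have h := nnreal_minkowski_sum univ (fun i ω => W ω * g i ω ^ r) (s := p / r)
    ((one_le_div hr).2 hp)
  have h2 := NNReal.rpow_le_rpow h (z := 1 / r) (by positivity)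
  refine le_trans (le_of_eq ?_) (h2.trans (le_of_eq ?_))
  · rw [← NNReal.rpow_mul]
    congr 1
    · refine sum_congr rfl fun i _ => ?_
      rw [← NNReal.rpow_mul]; congr 1; field_simp
    · field_simp
  · congr 1
    refine sum_congr rfl fun ω _ => ?_
    simp only [NNReal.mul_rpow, ← mul_sum, ← NNReal.rpow_mul]
    congr 1
    · rw [show p / r * (1 / (p / r)) = 1 by field_simp, NNReal.rpow_one]
    · rw [show r * (p / r) = p by field_simp, show 1 / (p / r) = 1 / p * r by field_simp]

/-! ### Mixed norms -/

/-- The mixed norm with exponents `p 0, …, p (m - 1)`, where `p 0` belongs to the outermost sum. -/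
noncomputable def mixedNorm {κ : Type*} [Fintype κ] :
    (m : ℕ) → (Fin m → ℝ) → ((Fin m → κ) → ℝ≥0) → ℝ≥0
  | 0, _, a => a Fin.elim0
  | m + 1, p, a =>
    (∑ i, mixedNorm m (fun k => p k.succ)
      (fun j => a (Fin.cons i j : Fin (m + 1) → κ)) ^ p 0) ^ (1 / p 0)

theorem mixedNorm_const {κ : Type*} [Fintype κ] {ρ : ℝ} (hρ : 0 < ρ) (m : ℕ)
    (a : (Fin m → κ) → ℝ≥0) :
    mixedNorm m (fun _ => ρ) a = (∑ j, a j ^ ρ) ^ (1 / ρ) := by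
  induction m with
  | zero =>
    rw [mixedNorm, Fintype.sum_unique, ← NNReal.rpow_mul, mul_one_div_cancel hρ.ne',
      NNReal.rpow_one]
    rfl
  | succ m ih =>
    rw [mixedNorm, sum_fin_cons]
    congr 1
    refine sum_congr rfl fun i _ => ?_
    rw [ih, ← NNReal.rpow_mul, one_div_mul_cancel hρ.ne', NNReal.rpow_one]

/-- Interpolation of mixed norms. -/
theorem mixedNorm_le_prod {κ σ : Type*} [Fintype κ] (s : Finset σ) (θ : σ → ℝ)
    (hθ : ∀ S ∈ s, 0 ≤ θ S) (hθ1 : ∑ S ∈ s, θ S = 1) (m : ℕ) (p : σ → Fin m → ℝ) (ρ : Fin m → ℝ)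
    (hp : ∀ S ∈ s, ∀ k, 0 < p S k) (hρ : ∀ k, 0 < ρ k)
    (h : ∀ k, ∑ S ∈ s, θ S / p S k = 1 / ρ k) (a : (Fin m → κ) → ℝ≥0) :
    mixedNorm m ρ a ≤ ∏ S ∈ s, mixedNorm m (p S) a ^ θ S := by
  induction m with
  | zero =>
    simp only [mixedNorm]
    rw [← NNReal.coe_le_coe]
    push_cast
    rw [← Real.rpow_sum_of_nonneg (NNReal.coe_nonneg _) hθ, hθ1, Real.rpow_one]
  | succ m ih =>
    simp only [mixedNorm]
    set b : σ → κ → ℝ≥0 := fun S i =>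
      mixedNorm m (fun k => p S k.succ) (fun j => a (Fin.cons i j : Fin (m + 1) → κ)) with hb
    have h0 : 0 < ρ 0 := hρ 0
    calc (∑ i, mixedNorm m (fun k => ρ k.succ)
          (fun j => a (Fin.cons i j : Fin (m + 1) → κ)) ^ ρ 0) ^ (1 / ρ 0)
        ≤ (∑ i, (∏ S ∈ s, b S i ^ θ S) ^ ρ 0) ^ (1 / ρ 0) := by
          refine NNReal.rpow_le_rpow (sum_le_sum fun i _ => ?_) (by positivity)
          exact NNReal.rpow_le_rpow (ih (fun S k => p S k.succ) (fun k => ρ k.succ)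
            (fun S hS k => hp S hS _) (fun k => hρ _) (fun k => h _) _) h0.le
      -- By `h 0` the new exponents `θ S / p S 0 * ρ 0` sum to 1, so they serve as Hölder weights.
      _ = (∑ i, ∏ S ∈ s, (b S i ^ p S 0) ^ (θ S / p S 0 * ρ 0)) ^ (1 / ρ 0) := by
          congr 1
          refine sum_congr rfl fun i _ => ?_
          rw [← NNReal.finsetProd_rpow]
          refine prod_congr rfl fun S hS => ?_
          have := (hp S hS 0).ne'
          rw [← NNReal.rpow_mul, ← NNReal.rpow_mul]
          congr 1; field_simp
      _ ≤ (∏ S ∈ s, (∑ i, b S i ^ p S 0) ^ (θ S / p S 0 * ρ 0)) ^ (1 / ρ 0) := by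
          refine NNReal.rpow_le_rpow (sum_prod_rpow_le s _ _ ?_ ?_) (by positivity)
          · rw [← sum_mul, h 0, one_div_mul_cancel h0.ne']
          · intro S hS
            have := hp S hS 0
            have := hθ S hS
            positivity
      _ = ∏ S ∈ s, ((∑ i, b S i ^ p S 0) ^ (1 / p S 0)) ^ θ S := by
          rw [← NNReal.finsetProd_rpow]
          refine prod_congr rfl fun S hS => ?_
          rw [← NNReal.rpow_mul, ← NNReal.rpow_mul]
          congr 1; field_simp

/-- If for every coordinate `k` the `ℓ_{p k}` sum of a family of vectors is controlled by a weighted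
`L_r` average of linear combinations, then so is the mixed norm of a family with several indices. -/
theorem mixedNorm_nnnorm_le {𝕜 Y κ Ω : Type*} [RCLike 𝕜] [NormedAddCommGroup Y] [NormedSpace 𝕜 Y]
    [Fintype κ] [Fintype Ω] {r : ℝ} (hr : 0 < r) (m : ℕ) (p : Fin m → ℝ) (hp : ∀ k, r ≤ p k)
    (A : Fin m → ℝ≥0) (w : Fin m → Ω → ℝ≥0) (c : Fin m → Ω → κ → 𝕜)
    (h : ∀ k (v : κ → Y), (∑ i, ‖v i‖₊ ^ p k) ^ (1 / p k)
      ≤ A k * (∑ ω, w k ω * ‖∑ i, c k ω i • v i‖₊ ^ r) ^ (1 / r))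
    (y : (Fin m → κ) → Y) :
    mixedNorm m p (fun j => ‖y j‖₊) ≤
      (∏ k, A k) * (∑ ω : Fin m → Ω,
        (∏ k, w k (ω k)) * ‖∑ j, (∏ k, c k (ω k) (j k)) • y j‖₊ ^ r) ^ (1 / r) := by
  induction m with
  | zero =>
    simp only [mixedNorm, univ_eq_empty, prod_empty, one_mul, one_smul, Fintype.sum_unique]
    rw [← NNReal.rpow_mul, mul_one_div_cancel hr.ne', NNReal.rpow_one]
    exact le_rfl
  | succ m ih =>
    have hp0 : 0 < p 0 := hr.trans_le (hp 0)
    rw [mixedNorm]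
    set L : κ → (Fin m → Ω) → Y := fun i ω =>
      ∑ j : Fin m → κ, (∏ k, c k.succ (ω k) (j k)) • y (Fin.cons i j : Fin (m + 1) → κ) with hL
    set W : (Fin m → Ω) → ℝ≥0 := fun ω => ∏ k, w k.succ (ω k) with hW
    set A' : ℝ≥0 := ∏ k : Fin m, A k.succ with hA'
    calc (∑ i, mixedNorm m (fun k => p k.succ)
          (fun j => ‖y (Fin.cons i j : Fin (m + 1) → κ)‖₊) ^ p 0) ^ (1 / p 0)
        ≤ (∑ i, (A' * (∑ ω, W ω * ‖L i ω‖₊ ^ r) ^ (1 / r)) ^ p 0) ^ (1 / p 0) := by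
          refine NNReal.rpow_le_rpow (sum_le_sum fun i _ => ?_) (by positivity)
          exact NNReal.rpow_le_rpow (ih (fun k => p k.succ) (fun k => hp _) (fun k => A k.succ)
            (fun k => w k.succ) (fun k => c k.succ) (fun k => h _) _) hp0.le
      _ = A' * (∑ i, ((∑ ω, W ω * ‖L i ω‖₊ ^ r) ^ (1 / r)) ^ p 0) ^ (1 / p 0) := by
          rw [sum_congr rfl fun i _ => NNReal.mul_rpow (x := A'), ← mul_sum, NNReal.mul_rpow, ← NNReal.rpow_mul, mul_one_div_cancel hp0.ne', NNReal.rpow_one]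
      -- The outer ℓ_{p 0} sum moves inside the L_r average. Only r ≤ p 0 matters, so the exponents
      -- may come in any order.
      _ ≤ A' * (∑ ω, W ω * ((∑ i, ‖L i ω‖₊ ^ p 0) ^ (1 / p 0)) ^ r) ^ (1 / r) := by
          gcongr
          exact nnreal_minkowski_mixed W (fun i ω => ‖L i ω‖₊) hr (hp 0)
      _ ≤ A' * (∑ ω, W ω *
            (A 0 * (∑ ω₀, w 0 ω₀ * ‖∑ i, c 0 ω₀ i • L i ω‖₊ ^ r) ^ (1 / r)) ^ r) ^ (1 / r) := by
          gcongr
          exact h 0 _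
      _ = (A 0 * A') * (∑ ω, W ω *
            (∑ ω₀, w 0 ω₀ * ‖∑ i, c 0 ω₀ i • L i ω‖₊ ^ r)) ^ (1 / r) := by
          have : ∀ ω : Fin m → Ω, W ω *
              (A 0 * (∑ ω₀, w 0 ω₀ * ‖∑ i, c 0 ω₀ i • L i ω‖₊ ^ r) ^ (1 / r)) ^ r
              = A 0 ^ r * (W ω * (∑ ω₀, w 0 ω₀ * ‖∑ i, c 0 ω₀ i • L i ω‖₊ ^ r)) := by
            intro ω
            rw [NNReal.mul_rpow, ← NNReal.rpow_mul, one_div_mul_cancel hr.ne', NNReal.rpow_one]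
            ring
          simp only [this]
          rw [← mul_sum, NNReal.mul_rpow, ← NNReal.rpow_mul, mul_one_div_cancel hr.ne',
            NNReal.rpow_one]
          ring
      _ = _ := by
          rw [Fin.prod_univ_succ, sum_fin_cons, sum_comm]
          congr 2
          refine sum_congr rfl fun ω _ => ?_
          rw [mul_sum]
          refine sum_congr rfl fun ω₀ _ => ?_
          rw [Fin.prod_univ_succ, sum_fin_cons]
          simp only [Fin.prod_univ_succ, Fin.cons_zero, Fin.cons_succ, hL, smul_sum, smul_smul, hW]
          ring

/-! ### Averages over signs -/

/-- The sign `±1` attached to a Boolean. -/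
def boolSign (b : Bool) : ℝ := bif b then 1 else -1

theorem abs_boolSign (b : Bool) : |boolSign b| = 1 := by cases b <;> simp [boolSign]

theorem boolSign_not (b : Bool) : boolSign (!b) = -boolSign b := by cases b <;> simp [boolSign]

theorem rademacher_one_of_mem_left {t : ℝ} (ht : t ∈ Set.Ioo (0 : ℝ) (1 / 2)) :
    rademacher 1 t = 1 := by
  have hpi := Real.pi_pos
  refine Real.sign_of_pos (Real.sin_pos_of_pos_of_lt_pi ?_ ?_)
  · have := ht.1; positivity
  · have := ht.2; nlinarith

theorem rademacher_one_of_mem_right {t : ℝ} (ht : t ∈ Set.Ioo (1 / 2 : ℝ) 1) :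
    rademacher 1 t = -1 := by
  have hpi := Real.pi_pos
  refine Real.sign_of_neg ?_
  have h : 0 < Real.sin (2 ^ 1 * Real.pi * t - Real.pi) :=
    Real.sin_pos_of_pos_of_lt_pi (by nlinarith [ht.1]) (by nlinarith [ht.2])
  rw [Real.sin_sub_pi] at h
  linarith

theorem rademacher_succ (k : ℕ) (t : ℝ) : rademacher (k + 1) t = rademacher k (2 * t) := by
  unfold rademacher
  congr 2
  ring

theorem rademacher_sub_one (k : ℕ) (t : ℝ) : rademacher (k + 1) (t - 1) = rademacher (k + 1) t := by
  unfold rademacher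
  congr 1
  rw [← Real.sin_sub_nat_mul_two_pi (2 ^ (k + 1) * Real.pi * t) (2 ^ k)]
  congr 1
  push_cast
  ring

/-- The first n Rademacher functions are distributed like independent signs. On each half of [0, 1]
the first function is constant and the later ones are rescaled copies of the whole system. Open
intervals avoid the zeros of the Rademacher functions; integrability is part of the induction
because F is arbitrary. -/
theorem integral_comp_rademacher (n : ℕ) (F : (Fin n → ℝ) → ℝ) :
    IntervalIntegrable (fun t => F fun k => rademacher (k + 1) t) MeasureTheory.volume 0 1 ∧
      ∫ t in (0 : ℝ)..1, F (fun k => rademacher (k + 1) t)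
        = ((2 : ℝ) ^ n)⁻¹ * ∑ ε : Fin n → Bool, F fun k => boolSign (ε k) := by
  induction n with
  | zero =>
    have : ∀ x : Fin 0 → ℝ, F x = F 0 := fun x => congrArg F (Subsingleton.elim _ _)
    simp [this]
  | succ n ih =>
    set G : ℝ → ℝ → ℝ := fun s t =>
      F (Fin.cons s (fun k : Fin n => rademacher (k + 1) t) : Fin (n + 1) → ℝ) with hG
    have hleft : Set.EqOn (fun t => G 1 (2 * t)) (fun t => F fun k => rademacher (k + 1) t)
        (Set.uIoo 0 (1 / 2)) := by
      intro t ht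
      rw [Set.uIoo_of_le (by norm_num)] at ht
      refine congrArg F (funext fun k => ?_)
      refine Fin.cases ?_ (fun k => ?_) k
      · simpa using (rademacher_one_of_mem_left ht).symm
      · simpa using (rademacher_succ (k + 1) t).symm
    have hright : Set.EqOn (fun t => G (-1) (2 * t + -1))
        (fun t => F fun k => rademacher (k + 1) t) (Set.uIoo (1 / 2) 1) := by
      intro t ht
      rw [Set.uIoo_of_le (by norm_num)] at ht
      refine congrArg F (funext fun k => ?_)
      refine Fin.cases ?_ (fun k => ?_) k
      · simpa using (rademacher_one_of_mem_right ht).symm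
      · simp [← sub_eq_add_neg, rademacher_sub_one, rademacher_succ (k + 1) t]
    have h1 := ih fun x => F (Fin.cons 1 x : Fin (n + 1) → ℝ)
    have h2 := ih fun x => F (Fin.cons (-1) x : Fin (n + 1) → ℝ)
    have i1 : IntervalIntegrable (fun t => F fun k => rademacher (k + 1) t)
        MeasureTheory.volume 0 (1 / 2) := by
      refine IntervalIntegrable.congr_uIoo ?_ hleft
      have := h1.1.comp_mul_left (c := 2)
      simpa using this
    have i2 : IntervalIntegrable (fun t => F fun k => rademacher (k + 1) t)
        MeasureTheory.volume (1 / 2) 1 := by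
      refine IntervalIntegrable.congr_uIoo ?_ hright
      have := (h2.1.comp_add_right (-1)).comp_mul_left (c := 2)
      norm_num at this
      simpa using this
    refine ⟨i1.trans i2, ?_⟩
    rw [← intervalIntegral.integral_add_adjacent_intervals i1 i2,
      ← intervalIntegral.integral_congr_uIoo hleft, ← intervalIntegral.integral_congr_uIoo hright,
      intervalIntegral.integral_comp_mul_left (G 1) two_ne_zero,
      intervalIntegral.integral_comp_mul_add (G (-1)) two_ne_zero]
    norm_num
    rw [h1.2, h2.2, sum_fin_cons, Fintype.sum_bool, pow_succ]
    have e : ∀ (b : Bool) (ε : Fin n → Bool),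
        (fun k => boolSign ((Fin.cons b ε : Fin (n + 1) → Bool) k))
          = (Fin.cons (boolSign b) (fun k => boolSign (ε k)) : Fin (n + 1) → ℝ) := by
      intro b ε
      refine funext fun k => ?_
      refine Fin.cases ?_ (fun k => ?_) k <;> simp
    simp only [e, show boolSign true = 1 from rfl, show boolSign false = -1 from rfl, mul_inv]
    ring

theorem rademacherNorm_eq (𝕜 : Type*) [RCLike 𝕜] {E : Type*} [NormedAddCommGroup E]
    [NormedSpace 𝕜 E] (p : ℝ) {n : ℕ} (x : Fin n → E) :
    rademacherNorm 𝕜 p x = (((2 : ℝ) ^ n)⁻¹ *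
      ∑ ε : Fin n → Bool, ‖∑ k, ((boolSign (ε k) : ℝ) : 𝕜) • x k‖ ^ p) ^ (1 / p) := by
  rw [rademacherNorm,
    (integral_comp_rademacher n fun s => ‖∑ k, ((s k : ℝ) : 𝕜) • x k‖ ^ p).2]

/-! ### Poincaré inequalities on the discrete cube -/

/-- Flip the `i`-th coordinate of a point of the discrete cube. -/
def flipAt {n : ℕ} (i : Fin n) (ε : Fin n → Bool) : Fin n → Bool :=
  Function.update ε i (!ε i)

theorem flipAt_involutive {n : ℕ} (i : Fin n) : Function.Involutive (flipAt i) := by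
  intro ε
  simp [flipAt]

/-- The antipode of a point of the discrete cube. -/
def antipode {n : ℕ} (ε : Fin n → Bool) : Fin n → Bool := fun k => !ε k

theorem antipode_involutive {n : ℕ} : Function.Involutive (antipode (n := n)) := by
  intro ε
  funext k
  simp [antipode]

theorem antipode_flipAt {n : ℕ} (i : Fin n) (ε : Fin n → Bool) :
    antipode (flipAt i ε) = flipAt i (antipode ε) := by
  funext k
  by_cases h : k = i
  · subst h; simp [antipode, flipAt]
  · simp [antipode, flipAt, h]

theorem sum_antipode {n : ℕ} (f : (Fin n → Bool) → ℝ) : ∑ ε, f (antipode ε) = ∑ ε, f ε :=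
  Equiv.sum_comp antipode_involutive.toPerm f

/-- The Dirichlet form on the discrete cube. -/
def cubeEnergy {n : ℕ} (f : (Fin n → Bool) → ℝ) : ℝ :=
  ∑ ε, ∑ i, (f ε - f (flipAt i ε)) ^ 2

theorem cubeEnergy_antipode {n : ℕ} (f : (Fin n → Bool) → ℝ) :
    cubeEnergy (fun ε => f (antipode ε)) = cubeEnergy f := by
  unfold cubeEnergy
  simp only [antipode_flipAt]
  exact sum_antipode fun ε => ∑ i, (f ε - f (flipAt i ε)) ^ 2

theorem flipAt_zero_cons {n : ℕ} (b : Bool) (ε : Fin n → Bool) :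
    flipAt 0 (Fin.cons b ε : Fin (n + 1) → Bool) = (Fin.cons (!b) ε : Fin (n + 1) → Bool) := by
  simp [flipAt]

theorem flipAt_succ_cons {n : ℕ} (i : Fin n) (b : Bool) (ε : Fin n → Bool) :
    flipAt i.succ (Fin.cons b ε : Fin (n + 1) → Bool)
      = (Fin.cons b (flipAt i ε) : Fin (n + 1) → Bool) := by
  simp [flipAt, Fin.cons_update]

theorem cubeEnergy_succ {n : ℕ} (f : (Fin (n + 1) → Bool) → ℝ) :
    cubeEnergy f = cubeEnergy (fun ε => f (Fin.cons true ε : Fin (n + 1) → Bool))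
      + cubeEnergy (fun ε => f (Fin.cons false ε : Fin (n + 1) → Bool))
      + 2 * ∑ ε : Fin n → Bool, (f (Fin.cons true ε : Fin (n + 1) → Bool)
          - f (Fin.cons false ε : Fin (n + 1) → Bool)) ^ 2 := by
  unfold cubeEnergy
  rw [sum_fin_cons, Fintype.sum_bool, two_mul, ← sum_add_distrib, ← sum_add_distrib,
    ← sum_add_distrib, ← sum_add_distrib]
  refine sum_congr rfl fun ε _ => ?_
  simp only [Fin.sum_univ_succ, flipAt_zero_cons, flipAt_succ_cons, Bool.not_true, Bool.not_false]
  ring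

/-- Induction on the dimension: the two half cubes contribute their own variances plus the square of
the difference of their sums, and Cauchy–Schwarz bounds the latter by the energy of the edges
joining the halves. -/
theorem cube_poincare {n : ℕ} (f : (Fin n → Bool) → ℝ) :
    2 ^ n * ∑ ε, f ε ^ 2 - (∑ ε, f ε) ^ 2 ≤ 2 ^ n / 4 * cubeEnergy f := by
  induction n with
  | zero => simp [cubeEnergy]
  | succ n ih =>
    have ha := ih fun ε => f (Fin.cons true ε : Fin (n + 1) → Bool)
    have hb := ih fun ε => f (Fin.cons false ε : Fin (n + 1) → Bool)
    have hc := sq_sum_le_card_mul_sum_sq (s := (univ : Finset (Fin n → Bool)))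
      (f := fun ε => f (Fin.cons true ε : Fin (n + 1) → Bool)
        - f (Fin.cons false ε : Fin (n + 1) → Bool))
    rw [sum_sub_distrib, card_univ, Fintype.card_fun, Fintype.card_bool, Fintype.card_fin] at hc
    push_cast at hc
    rw [cubeEnergy_succ, sum_fin_cons, sum_fin_cons, Fintype.sum_bool, Fintype.sum_bool, pow_succ]
    nlinarith

/-- Even functions on the discrete cube have no part of degree one, so that their Poincaré
inequality improves by a factor `2`. -/
theorem cube_poincare_of_even {n : ℕ} (f : (Fin n → Bool) → ℝ)
    (hf : ∀ ε, f (antipode ε) = f ε) :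
    2 * (2 ^ n * ∑ ε, f ε ^ 2 - (∑ ε, f ε) ^ 2) ≤ 2 ^ n / 4 * cubeEnergy f := by
  induction n with
  | zero => simp [cubeEnergy]
  | succ n ih =>
    set g : (Fin n → Bool) → ℝ := fun ε => f (Fin.cons true ε : Fin (n + 1) → Bool) with hg
    have hfalse : ∀ ε : Fin n → Bool,
        f (Fin.cons false ε : Fin (n + 1) → Bool) = g (antipode ε) := by
      intro ε
      rw [← hf]
      refine congrArg f (funext fun k => ?_)
      refine Fin.cases ?_ (fun k => ?_) k <;> simp [antipode]
    -- Split the restriction to a half cube into its even and odd parts. The induction hypothesis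
    -- applies to `e`. The odd part has sum 0 and satisfies only the ordinary inequality; the edges
    -- joining the half cubes have energy proportional to ∑ o² and supply the missing factor 2.
    set e : (Fin n → Bool) → ℝ := fun ε => (g ε + g (antipode ε)) / 2 with he
    set o : (Fin n → Bool) → ℝ := fun ε => (g ε - g (antipode ε)) / 2 with ho
    have h1 := ih e fun ε => by simp only [he, antipode_involutive ε]; ring
    have h2 := cube_poincare o
    have hse : ∑ ε, e ε = ∑ ε, g ε := by
      simp only [he, ← sum_div, sum_add_distrib, sum_antipode g]; ring
    have hso : ∑ ε, o ε = 0 := by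
      simp only [ho, ← sum_div, sum_sub_distrib, sum_antipode g]; ring
    have hsq : ∑ ε, e ε ^ 2 + ∑ ε, o ε ^ 2 = ∑ ε, g ε ^ 2 := by
      have : ∑ ε, g ε ^ 2 = ∑ ε, (g ε ^ 2 + g (antipode ε) ^ 2) / 2 := by
        rw [← sum_div, sum_add_distrib, sum_antipode fun ε => g ε ^ 2]; ring
      rw [this, ← sum_add_distrib]
      exact sum_congr rfl fun ε _ => by simp only [he, ho]; ring
    have hen : cubeEnergy e + cubeEnergy o = cubeEnergy g := by
      have : cubeEnergy g = (cubeEnergy g + cubeEnergy fun ε => g (antipode ε)) / 2 := by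
        rw [cubeEnergy_antipode]; ring
      rw [this]
      unfold cubeEnergy
      rw [← sum_add_distrib, ← sum_add_distrib, sum_div]
      refine sum_congr rfl fun ε _ => ?_
      rw [← sum_add_distrib, ← sum_add_distrib, sum_div]
      exact sum_congr rfl fun i _ => by simp only [he, ho]; ring
    have hdiff : ∑ ε, (g ε - g (antipode ε)) ^ 2 = 4 * ∑ ε, o ε ^ 2 := by
      rw [mul_sum]
      exact sum_congr rfl fun ε _ => by simp only [ho]; ring
    rw [cubeEnergy_succ, sum_fin_cons, sum_fin_cons, Fintype.sum_bool, Fintype.sum_bool, pow_succ]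
    simp only [hfalse]
    rw [cubeEnergy_antipode, sum_antipode g, sum_antipode fun ε => g ε ^ 2, hdiff, ← hen, ← hsq,
      ← hse]
    rw [hso] at h2
    nlinarith

/-! ### The Kahane–Khintchine inequality -/

/-- The argument of Latała and Oleszkiewicz. -/
theorem two_pow_mul_sum_sq_le {𝕜 : Type*} [RCLike 𝕜] {E : Type*} [NormedAddCommGroup E]
    [NormedSpace 𝕜 E] {n : ℕ} (x : Fin n → E) :
    2 ^ n * ∑ ε : Fin n → Bool, ‖∑ k, ((boolSign (ε k) : ℝ) : 𝕜) • x k‖ ^ 2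
      ≤ 2 * (∑ ε : Fin n → Bool, ‖∑ k, ((boolSign (ε k) : ℝ) : 𝕜) • x k‖) ^ 2 := by
  set S : (Fin n → Bool) → E := fun ε => ∑ k, ((boolSign (ε k) : ℝ) : 𝕜) • x k with hS
  set f : (Fin n → Bool) → ℝ := fun ε => ‖S ε‖ with hf
  have heven : ∀ ε, f (antipode ε) = f ε := by
    intro ε
    have : S (antipode ε) = -S ε := by
      simp [hS, antipode, boolSign_not, sum_neg_distrib]
    simp [hf, this]
  have hflip : ∀ ε i, S (flipAt i ε) = S ε - (2 : 𝕜) • ((boolSign (ε i) : ℝ) : 𝕜) • x i := by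
    intro ε i
    rw [eq_sub_iff_add_eq, ← eq_sub_iff_add_eq', hS]
    simp only
    rw [← sum_sub_distrib, sum_eq_single i]
    · simp only [flipAt, Function.update_self, boolSign_not, two_smul]
      push_cast
      rw [neg_smul]; abel
    · intro k _ hk
      simp [flipAt, hk]
    · simp
  -- Summing S over all single flips gives (n - 2) S, since each term x_k changes sign exactly once.
  have hlow : ∀ ε, ((n : ℝ) - 2) * f ε ≤ ∑ i, f (flipAt i ε) := by
    intro ε
    have h1 : ∑ i, S (flipAt i ε) = (((n : ℝ) - 2 : ℝ) : 𝕜) • S ε := by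
      simp only [hflip, sum_sub_distrib, ← smul_sum]
      rw [sum_const, card_univ, Fintype.card_fin]
      push_cast
      rw [sub_smul, Nat.cast_smul_eq_nsmul]
    calc ((n : ℝ) - 2) * f ε ≤ |(n : ℝ) - 2| * f ε := by
          gcongr
          exact le_abs_self _
      _ = ‖∑ i, S (flipAt i ε)‖ := by rw [h1, norm_smul, RCLike.norm_ofReal]
      _ ≤ _ := norm_sum_le _ _
  have henergy : cubeEnergy f ≤ 4 * ∑ ε, f ε ^ 2 := by
    have h1 : ∑ ε, ∑ i, f (flipAt i ε) ^ 2 = n * ∑ ε, f ε ^ 2 := by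
      have h0 : ∀ i, ∑ ε, f (flipAt i ε) ^ 2 = ∑ ε, f ε ^ 2 := fun i =>
        Equiv.sum_comp (flipAt_involutive i).toPerm fun ε => f ε ^ 2
      rw [sum_comm, sum_congr rfl fun i _ => h0 i]
      simp
    have h2 : cubeEnergy f = 2 * n * ∑ ε, f ε ^ 2 - 2 * ∑ ε, f ε * ∑ i, f (flipAt i ε) := by
      have h3 : ∀ ε, ∑ i, (f ε - f (flipAt i ε)) ^ 2
          = n * f ε ^ 2 - 2 * (f ε * ∑ i, f (flipAt i ε)) + ∑ i, f (flipAt i ε) ^ 2 := by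
        intro ε
        simp only [sub_sq, sum_add_distrib, sum_sub_distrib, mul_assoc, ← mul_sum]
        simp
      unfold cubeEnergy
      simp only [h3, sum_add_distrib, sum_sub_distrib, ← mul_sum, h1]
      ring
    have h4 : ((n : ℝ) - 2) * ∑ ε, f ε ^ 2 ≤ ∑ ε, f ε * ∑ i, f (flipAt i ε) := by
      rw [mul_sum]
      refine sum_le_sum fun ε _ => ?_
      have := mul_le_mul_of_nonneg_left (hlow ε) (norm_nonneg (S ε))
      calc _ = f ε * (((n : ℝ) - 2) * f ε) := by ring
        _ ≤ _ := this
    rw [h2]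
    linarith
  -- With energy at most 4 ∑ f² the ordinary Poincaré inequality would be vacuous; the gain of 2 for
  -- even functions is what gives the result.
  have h := cube_poincare_of_even f heven
  have h5 : (2 : ℝ) ^ n / 4 * cubeEnergy f ≤ 2 ^ n / 4 * (4 * ∑ ε, f ε ^ 2) := by gcongr
  linarith

theorem sum_inv_two_pow (n : ℕ) : ∑ _ε : Fin n → Bool, ((2 : ℝ) ^ n)⁻¹ = 1 := by
  simp

/-- The L_1 average is at most the L_r average, so r = 1 suffices. Admissible constants must be
exhibited because the infimum of the empty set of reals is 0. -/
theorem isKahaneConst_sqrt_two (𝕜 : Type*) [RCLike 𝕜] {r : ℝ} (hr : 1 ≤ r) :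
    IsKahaneConst.{v} 𝕜 r 2 (Real.sqrt 2) := by
  refine ⟨by positivity, fun E _ _ _ n x => ?_⟩
  rw [rademacherNorm_eq, rademacherNorm_eq]
  set f : (Fin n → Bool) → ℝ := fun ε => ‖∑ k, ((boolSign (ε k) : ℝ) : 𝕜) • x k‖ with hf
  have h1 : ((2 : ℝ) ^ n)⁻¹ * ∑ ε, f ε ≤ (((2 : ℝ) ^ n)⁻¹ * ∑ ε, f ε ^ r) ^ (1 / r) := by
    rw [mul_sum, mul_sum]
    exact Real.arith_mean_le_rpow_mean univ (fun _ => ((2 : ℝ) ^ n)⁻¹) f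
      (fun _ _ => by positivity) (sum_inv_two_pow n) (fun _ _ => norm_nonneg _) hr
  have h2 := two_pow_mul_sum_sq_le (𝕜 := 𝕜) x
  refine le_trans ?_ (mul_le_mul_of_nonneg_left h1 (Real.sqrt_nonneg 2))
  rw [← Real.sqrt_eq_rpow]
  refine Real.sqrt_le_iff.2 ⟨?_, ?_⟩
  · have : 0 ≤ ∑ ε, f ε := sum_nonneg fun _ _ => norm_nonneg _
    positivity
  · rw [mul_pow, Real.sq_sqrt zero_le_two, mul_pow]
    simp only [Real.rpow_two]
    have hN : (0 : ℝ) < 2 ^ n := by positivity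
    calc ((2 : ℝ) ^ n)⁻¹ * ∑ ε, f ε ^ 2 = ((2 : ℝ) ^ n)⁻¹ ^ 2 * (2 ^ n * ∑ ε, f ε ^ 2) := by
          field_simp
      _ ≤ ((2 : ℝ) ^ n)⁻¹ ^ 2 * (2 * (∑ ε, f ε) ^ 2) := by gcongr
      _ = _ := by ring

/-! ### The cotype inequality with the optimal constants -/

theorem rademacherNorm_nonneg (𝕜 : Type*) [RCLike 𝕜] {E : Type*} [NormedAddCommGroup E]
    [NormedSpace 𝕜 E] (p : ℝ) {n : ℕ} (x : Fin n → E) : 0 ≤ rademacherNorm 𝕜 p x := by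
  rw [rademacherNorm_eq]
  exact Real.rpow_nonneg (mul_nonneg (by positivity)
    (sum_nonneg fun _ _ => Real.rpow_nonneg (norm_nonneg _) _)) _

theorem le_csInf_mul {s : Set ℝ} (hs : s.Nonempty) {a b : ℝ} (hb : 0 ≤ b)
    (h : ∀ C ∈ s, a ≤ C * b) : a ≤ sInf s * b := by
  rcases hb.eq_or_lt with rfl | hb
  · obtain ⟨C, hC⟩ := hs
    simpa using h C hC
  · rw [← div_le_iff₀ hb]
    exact le_csInf hs fun C hC => (div_le_iff₀ hb).2 (h C hC)

theorem constA_nonneg (𝕜 : Type*) [RCLike 𝕜] (q r : ℝ) (Y : Type v) [NormedAddCommGroup Y]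
    [NormedSpace 𝕜 Y] : 0 ≤ constA 𝕜 q r Y :=
  mul_nonneg (Real.sInf_nonneg fun _ h => h.1.le) (Real.sInf_nonneg fun _ h => h.1.le)

theorem cotype_le_constA {𝕜 : Type*} [RCLike 𝕜] {q r : ℝ} {Y : Type v} [NormedAddCommGroup Y]
    [NormedSpace 𝕜 Y] [CompleteSpace Y] (hY : HasCotype 𝕜 q Y) (hr : 1 ≤ r) {n : ℕ}
    (x : Fin n → Y) :
    (∑ k, ‖x k‖ ^ q) ^ (1 / q) ≤ constA 𝕜 q r Y * rademacherNorm 𝕜 r x := by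
  have h1 : (∑ k, ‖x k‖ ^ q) ^ (1 / q) ≤ cotypeConst 𝕜 q Y * rademacherNorm 𝕜 2 x :=
    le_csInf_mul hY (rademacherNorm_nonneg 𝕜 2 x) fun C hC => hC.2 n x
  have h2 : rademacherNorm 𝕜 2 x ≤ kahaneConst.{v} 𝕜 r 2 * rademacherNorm 𝕜 r x :=
    le_csInf_mul ⟨_, isKahaneConst_sqrt_two 𝕜 hr⟩ (rademacherNorm_nonneg 𝕜 r x)
      fun K hK => hK.2 Y n x
  calc _ ≤ _ := h1
    _ ≤ cotypeConst 𝕜 q Y * (kahaneConst.{v} 𝕜 r 2 * rademacherNorm 𝕜 r x) :=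
        mul_le_mul_of_nonneg_left h2 (Real.sInf_nonneg fun _ h => h.1.le)
    _ = _ := by rw [constA, mul_assoc]

/-! ### Uniform boundedness for multilinear maps -/

/-- The Banach–Steinhaus theorem for families of continuous multilinear maps. -/
theorem multilinear_banach_steinhaus {𝕜 ι α : Type*} [RCLike 𝕜] [Fintype ι] [DecidableEq ι]
    {X : ι → Type*} [∀ k, NormedAddCommGroup (X k)] [∀ k, NormedSpace 𝕜 (X k)]
    [∀ k, CompleteSpace (X k)] {Z : α → Type*} [∀ w, NormedAddCommGroup (Z w)]
    [∀ w, NormedSpace 𝕜 (Z w)] (T : ∀ w, ContinuousMultilinearMap 𝕜 X (Z w)) (b : α → ℝ)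
    (hb : ∀ w, 0 ≤ b w) (h : ∀ z, ∃ C : ℝ, ∀ w, ‖T w z‖ ≤ C * b w) :
    ∃ C : ℝ, 0 ≤ C ∧ ∀ w z, ‖T w z‖ ≤ C * (∏ k, ‖z k‖) * b w := by
  have hclosed : ∀ c : ℕ, IsClosed {z : ∀ k, X k | ∀ w, ‖T w z‖ ≤ c * b w} := by
    intro c
    simp only [Set.ofPred_forall]
    exact isClosed_iInter fun w => isClosed_le (T w).cont.norm continuous_const
  have hcover : ⋃ c : ℕ, {z : ∀ k, X k | ∀ w, ‖T w z‖ ≤ c * b w} = Set.univ := by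
    refine Set.eq_univ_of_forall fun z => ?_
    obtain ⟨C, hC⟩ := h z
    obtain ⟨c, hc⟩ := exists_nat_ge C
    exact Set.mem_iUnion.2 ⟨c, fun w => (hC w).trans (mul_le_mul_of_nonneg_right hc (hb w))⟩
  -- Baire's theorem: one of the closed sets contains a ball around some `a`.
  obtain ⟨c, a, ha⟩ := nonempty_interior_of_iUnion_of_closed hclosed hcover
  obtain ⟨δ, hδ, hball⟩ := Metric.isOpen_iff.1 isOpen_interior a ha
  have hball' : ∀ z, dist z a < δ → ∀ w, ‖T w z‖ ≤ c * b w := fun z hz =>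
    interior_subset (hball hz)
  set K : ℝ := 2 ^ Fintype.card ι * c with hK
  have hsmall : ∀ z : ∀ k, X k, (∀ k, ‖z k‖ < δ) → ∀ w, ‖T w z‖ ≤ K * b w := by
    intro z hz w
    -- Expanding T at (a + z) + (-a) gives 2^card terms. Up to sign, each is a value at a point with
    -- coordinates a + z or a, which lies in the ball.
    have hz' : z = (a + z) + (-a) := by abel
    rw [hz', ContinuousMultilinearMap.map_add_univ]
    refine (norm_sum_le _ _).trans ?_
    have hterm : ∀ s : Finset ι, ‖T w (s.piecewise (a + z) (-a))‖ ≤ c * b w := by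
      intro s
      have hs : s.piecewise (a + z) (-a) =
          fun k => (if k ∈ s then (1 : 𝕜) else -1) • s.piecewise (a + z) a k := by
        funext k
        by_cases hk : k ∈ s <;> simp [hk]
      rw [hs, ContinuousMultilinearMap.map_smul_univ, norm_smul, norm_prod]
      have h1 : ∏ k, ‖(if k ∈ s then (1 : 𝕜) else -1)‖ = 1 :=
        prod_eq_one fun k _ => by split_ifs <;> simp
      rw [h1, one_mul]
      refine hball' _ ((dist_pi_lt_iff hδ).2 fun k => ?_) w
      by_cases hk : k ∈ s
      · simpa [hk] using hz k
      · simpa [hk] using hδ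
    calc ∑ s : Finset ι, ‖T w (s.piecewise (a + z) (-a))‖ ≤ ∑ _s : Finset ι, c * b w :=
          sum_le_sum fun s _ => hterm s
      _ = K * b w := by simp [hK, mul_assoc]
  refine ⟨K * (2 / δ) ^ Fintype.card ι, by positivity, fun w z => ?_⟩
  by_cases hz : ∃ k, z k = 0
  · obtain ⟨k, hk⟩ := hz
    rw [(T w).map_coord_zero k hk, norm_zero]
    have := hb w
    positivity
  push Not at hz
  have hpos : ∀ k, 0 < ‖z k‖ := fun k => norm_pos_iff.2 (hz k)
  have hzz : z = fun k => ((2 / δ * ‖z k‖ : ℝ) : 𝕜) • ((δ / 2 / ‖z k‖ : ℝ) : 𝕜) • z k := by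
    funext k
    have := (hpos k).ne'
    rw [smul_smul, ← RCLike.ofReal_mul, show 2 / δ * ‖z k‖ * (δ / 2 / ‖z k‖) = 1 by field_simp,
      RCLike.ofReal_one, one_smul]
  have hs := hsmall (fun k => ((δ / 2 / ‖z k‖ : ℝ) : 𝕜) • z k) (fun k => by
    have := hpos k
    rw [norm_smul, RCLike.norm_ofReal, abs_of_pos (by positivity), div_mul_cancel₀ _ this.ne']
    linarith) w
  calc ‖T w z‖ = (∏ k, (2 / δ * ‖z k‖)) * ‖T w fun k => ((δ / 2 / ‖z k‖ : ℝ) : 𝕜) • z k‖ := by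
        conv_lhs => rw [hzz, ContinuousMultilinearMap.map_smul_univ, norm_smul, norm_prod]
        congr 1
        refine prod_congr rfl fun k _ => ?_
        rw [RCLike.norm_ofReal, abs_of_nonneg (by positivity)]
    _ ≤ (∏ k, (2 / δ * ‖z k‖)) * (K * b w) :=
        mul_le_mul_of_nonneg_left hs (prod_nonneg fun k _ => by positivity)
    _ = _ := by rw [prod_mul_distrib, prod_const, card_univ]; ring

/-! ### Weak norms and summing norms -/

section WeakNorm

variable {𝕜 : Type*} [RCLike 𝕜] {E : Type*} [NormedAddCommGroup E] [NormedSpace 𝕜 E] {n : ℕ}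

theorem weakL1Norm_nonneg (x : Fin n → E) : 0 ≤ weakL1Norm 𝕜 x :=
  Real.iSup_nonneg fun _ => sum_nonneg fun _ _ => norm_nonneg _

theorem sum_norm_apply_le_weakL1Norm (x : Fin n → E) (φ : E →L[𝕜] 𝕜) (hφ : ‖φ‖ ≤ 1) :
    ∑ i, ‖φ (x i)‖ ≤ weakL1Norm 𝕜 x := by
  refine le_ciSup (f := fun φ : {φ : E →L[𝕜] 𝕜 // ‖φ‖ ≤ 1} => ∑ i, ‖φ.1 (x i)‖)
    ⟨∑ i, ‖x i‖, ?_⟩ ⟨φ, hφ⟩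
  rintro _ ⟨ψ, rfl⟩
  exact sum_le_sum fun i _ => (ψ.1.le_opNorm (x i)).trans
    (mul_le_of_le_one_left (norm_nonneg _) ψ.2)

/-- Test the sum against a norming functional. This controls the randomized vectors put into the
coordinates outside S. -/
theorem norm_sum_smul_le_weakL1Norm (x : Fin n → E) (c : Fin n → 𝕜) (hc : ∀ i, ‖c i‖ ≤ 1) :
    ‖∑ i, c i • x i‖ ≤ weakL1Norm 𝕜 x := by
  obtain ⟨φ, hφ, h⟩ := exists_dual_vector'' 𝕜 (∑ i, c i • x i)
  calc ‖∑ i, c i • x i‖ = ‖φ (∑ i, c i • x i)‖ := by rw [h]; simp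
    _ ≤ ∑ i, ‖c i • φ (x i)‖ := by
        rw [map_sum]
        simpa only [map_smul] using norm_sum_le univ fun i => c i • φ (x i)
    _ ≤ ∑ i, ‖φ (x i)‖ := sum_le_sum fun i _ => by
        rw [norm_smul]
        exact mul_le_of_le_one_left (norm_nonneg _) (hc i)
    _ ≤ _ := sum_norm_apply_le_weakL1Norm x φ hφ

theorem prod_weakL1Norm_nonneg {ι : Type*} [Fintype ι] {X : ι → Type*}
    [∀ k, NormedAddCommGroup (X k)] [∀ k, NormedSpace 𝕜 (X k)] (x : ∀ k, Fin n → X k) :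
    0 ≤ ∏ k, weakL1Norm 𝕜 (x k) :=
  prod_nonneg fun _ _ => weakL1Norm_nonneg _

end WeakNorm

section SummingNorm

variable {𝕜 : Type*} [RCLike 𝕜] {ι : Type*} [Fintype ι] [DecidableEq ι]
  {X : ι → Type u} [∀ k, NormedAddCommGroup (X k)] [∀ k, NormedSpace 𝕜 (X k)]
  {Y : Type v} [NormedAddCommGroup Y] [NormedSpace 𝕜 Y]

theorem partialNorm_nonneg (r : ℝ) (U : ContinuousMultilinearMap 𝕜 X Y) (S : Finset ι) :
    0 ≤ partialNorm r U S :=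
  Real.sInf_nonneg fun _ h => h.1

theorem IsMultipleSumming.sum_le {r : ℝ} {U : ContinuousMultilinearMap 𝕜 X Y}
    (hU : IsMultipleSumming r U) {n : ℕ} (x : ∀ k, Fin n → X k) :
    (∑ i : ι → Fin n, ‖U (fun k => x k (i k))‖ ^ r) ^ (1 / r)
      ≤ summingNorm r U * ∏ k, weakL1Norm 𝕜 (x k) :=
  le_csInf_mul hU (prod_weakL1Norm_nonneg x) fun _ hC => hC.2 n x

/-- A nonnegative constant which satisfies the summing inequality bounds the summing norm. -/
theorem isMultipleSumming_and_summingNorm_le {r B : ℝ} {U : ContinuousMultilinearMap 𝕜 X Y}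
    (hB : 0 ≤ B) (h : ∀ (n : ℕ) (x : ∀ k, Fin n → X k),
      (∑ i : ι → Fin n, ‖U (fun k => x k (i k))‖ ^ r) ^ (1 / r) ≤ B * ∏ k, weakL1Norm 𝕜 (x k)) :
    IsMultipleSumming r U ∧ summingNorm r U ≤ B := by
  -- Admissible constants are positive by definition, whereas `B` may be 0.
  have key : ∀ ε : ℝ, 0 < ε → IsSummingConst r U (B + ε) := fun ε hε =>
    ⟨by positivity, fun n x => (h n x).trans
      (mul_le_mul_of_nonneg_right (by linarith) (prod_weakL1Norm_nonneg x))⟩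
  exact ⟨⟨_, key 1 one_pos⟩, le_of_forall_pos_le_add fun ε hε =>
    csInf_le ⟨0, fun _ hC => hC.1.le⟩ (key ε hε)⟩

theorem PartialBounded.summingNorm_le {r : ℝ} {U : ContinuousMultilinearMap 𝕜 X Y} {S : Finset ι}
    (h : PartialBounded r U S) (z : ∀ k : {k // ¬ k ∈ S}, X k) :
    summingNorm r (partialMap U S z) ≤ partialNorm r U S * ∏ k, ‖z k‖ :=
  le_csInf_mul h (prod_nonneg fun _ _ => norm_nonneg _) fun _ hC => hC.2 z

/-- The operator in the variables outside `S`, when the coordinates in `S` are fixed through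
`y`. -/
def coPartialMap (U : ContinuousMultilinearMap 𝕜 X Y) (S : Finset ι)
    (y : ∀ k : {k // k ∈ S}, X k) :
    ContinuousMultilinearMap 𝕜 (fun k : {k // ¬ k ∈ S} => X k) Y where
  toFun z := U fun j => if h : j ∈ S then y ⟨j, h⟩ else z ⟨j, h⟩
  map_update_add' z i a b := by
    classical
    repeat rw [MultilinearMap.domDomRestrict_aux_right]
    exact U.map_update_add _ _ _ _
  map_update_smul' z i c a := by
    classical
    repeat rw [MultilinearMap.domDomRestrict_aux_right]
    exact U.map_update_smul _ _ _ _
  cont := by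
    refine U.cont.comp (continuous_pi fun j => ?_)
    by_cases h : j ∈ S
    · simpa [h] using continuous_const
    · simpa [h] using continuous_apply (⟨j, h⟩ : {k // ¬ k ∈ S})

/-- A separately summing operator has bounded partial operators. -/
theorem IsMultipleSummingIn.partialBounded [∀ k, CompleteSpace (X k)] {r : ℝ} (hr : 1 ≤ r)
    {U : ContinuousMultilinearMap 𝕜 X Y} {S : Finset ι} (h : IsMultipleSummingIn r U S) :
    PartialBounded r U S := by
  have hr0 : 0 ≤ r := by linarith
  have : Fact (1 ≤ ENNReal.ofReal r) := ⟨ENNReal.one_le_ofReal.2 hr⟩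
  have htr : (ENNReal.ofReal r).toReal = r := ENNReal.toReal_ofReal hr0
  -- Each finite test family `w` in the coordinates of S gives a multilinear map into an ℓ_r space
  -- whose norm is the left side of the summing inequality. Summability of every U^S_z is then
  -- pointwise boundedness of this collection.
  let T : ∀ w : (Σ n : ℕ, ∀ k : {k // k ∈ S}, Fin n → X k), ContinuousMultilinearMap 𝕜
      (fun k : {k // ¬ k ∈ S} => X k)
      (PiLp (ENNReal.ofReal r) fun _ : {k // k ∈ S} → Fin w.1 => Y) := fun w =>
    (PiLp.continuousLinearEquiv (ENNReal.ofReal r) 𝕜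
      (fun _ : {k // k ∈ S} → Fin w.1 => Y)).symm.toContinuousLinearMap.compContinuousMultilinearMap
      (ContinuousMultilinearMap.pi fun i => coPartialMap U S fun k => w.2 k (i k))
  have hT : ∀ w z, ‖T w z‖
      = (∑ i : {k // k ∈ S} → Fin w.1, ‖partialMap U S z fun k => w.2 k (i k)‖ ^ r) ^ (1 / r) := by
    intro w z
    rw [PiLp.norm_eq_sum (by rw [htr]; linarith), htr]
    rfl
  obtain ⟨C, hC0, hC⟩ := multilinear_banach_steinhaus T (fun w => ∏ k, weakL1Norm 𝕜 (w.2 k))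
    (fun w => prod_weakL1Norm_nonneg w.2) fun z => by
      obtain ⟨C, hC⟩ := h z
      exact ⟨C, fun w => by rw [hT]; exact hC.2 w.1 w.2⟩
  refine ⟨C, hC0, fun z => (isMultipleSumming_and_summingNorm_le
    (mul_nonneg hC0 (prod_nonneg fun _ _ => norm_nonneg _)) fun n x => ?_).2⟩
  have := hC ⟨n, x⟩ z
  rwa [hT] at this

end SummingNorm

/-! ### Blei's inequality for families of vectors -/

theorem sum_comp_equiv_fun {β ι τ κ : Type*} [AddCommMonoid β] [Fintype ι] [Fintype τ]
    [Fintype κ] [DecidableEq ι] [DecidableEq τ] (e : ι ≃ τ) (f : (ι → κ) → β) :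
    ∑ j : τ → κ, f (j ∘ e) = ∑ j, f j :=
  (e.symm.arrowCongr (Equiv.refl κ)).sum_comp f

theorem prod_mem_mul_prod_not_mem {β ι : Type*} [CommMonoid β] [Fintype ι] [DecidableEq ι]
    (S : Finset ι) (f : ι → β) :
    (∏ k : {k // k ∈ S}, f k) * ∏ k : {k // ¬ k ∈ S}, f k = ∏ k, f k := by
  convert Fintype.prod_subtype_mul_prod_subtype (fun k => k ∈ S) f

/-- A combination of the interpolation of mixed norms with coordinatewise averaging. -/
theorem sum_nnnorm_rpow_le_prod {𝕜 Y ι κ Ω σ : Type*} [RCLike 𝕜] [NormedAddCommGroup Y]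
    [NormedSpace 𝕜 Y] [Fintype ι] [DecidableEq ι] [Fintype κ] [Fintype Ω] {r ρ : ℝ} (hr : 0 < r)
    (hρ : 0 < ρ)
    (s : Finset σ) (θ : σ → ℝ) (hθ : ∀ S ∈ s, 0 ≤ θ S) (hθ1 : ∑ S ∈ s, θ S = 1)
    (p : σ → ι → ℝ) (hp : ∀ S ∈ s, ∀ k, r ≤ p S k)
    (hpρ : ∀ k, ∑ S ∈ s, θ S / p S k = 1 / ρ)
    (A : σ → ι → ℝ≥0) (w : σ → ι → Ω → ℝ≥0) (c : Ω → κ → 𝕜)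
    (h : ∀ S ∈ s, ∀ k (v : κ → Y), (∑ i, ‖v i‖₊ ^ p S k) ^ (1 / p S k)
      ≤ A S k * (∑ ω, w S k ω * ‖∑ i, c ω i • v i‖₊ ^ r) ^ (1 / r))
    (y : (ι → κ) → Y) :
    (∑ j, ‖y j‖₊ ^ ρ) ^ (1 / ρ) ≤ ∏ S ∈ s, ((∏ k, A S k) * (∑ ω : ι → Ω,
        (∏ k, w S k (ω k)) * ‖∑ j, (∏ k, c (ω k) (j k)) • y j‖₊ ^ r) ^ (1 / r)) ^ θ S := by
  -- Mixed norms need an ordering of the coordinates; any one will do.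
  let e := Fintype.equivFin ι
  let a : (Fin (Fintype.card ι) → κ) → Y := fun j => y (j ∘ e)
  have h1 := mixedNorm_le_prod s θ hθ hθ1 _ (fun S k => p S (e.symm k)) (fun _ => ρ)
    (fun S hS k => hr.trans_le (hp S hS _)) (fun _ => hρ) (fun k => hpρ _) fun j => ‖a j‖₊
  rw [mixedNorm_const hρ, sum_comp_equiv_fun e fun j => ‖y j‖₊ ^ ρ] at h1
  refine h1.trans (prod_le_prod' fun S hS => NNReal.rpow_le_rpow ?_ (hθ S hS))
  refine (mixedNorm_nnnorm_le hr _ _ (fun k => hp S hS _) (fun k => A S (e.symm k))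
    (fun k => w S (e.symm k)) (fun _ => c) (fun k => h S hS _) a).trans (le_of_eq ?_)
  rw [e.symm.prod_comp, ← sum_comp_equiv_fun e]
  congr 2
  refine sum_congr rfl fun ω _ => ?_
  rw [← e.symm.prod_comp]
  congr 1
  · simp
  · rw [← sum_comp_equiv_fun e fun j => (∏ k, c ((ω ∘ e) k) (j k)) • y j]
    congr 2
    refine sum_congr rfl fun j _ => ?_
    rw [← e.symm.prod_comp fun k => c ((ω ∘ e) k) ((j ∘ e) k)]
    simp [a]

/-- A given k lies in n / N of the n-subsets, so the mean reciprocal exponent is n / (N r) + (N - n)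
/ (N q). This is the origin of r_N. -/
theorem sum_powersetCard_div {ι : Type*} [Fintype ι] [DecidableEq ι] {q r : ℝ} (hq : 0 < q)
    (hr : 0 < r) {n : ℕ} (hn : n < Fintype.card ι) (k : ι) :
    ∑ S ∈ (univ : Finset ι).powersetCard n,
        (1 / ((Fintype.card ι).choose n : ℝ)) / (if k ∈ S then r else q)
      = 1 / (q * r * Fintype.card ι / (n * q + ((Fintype.card ι : ℝ) - n) * r)) := by
  set N := Fintype.card ι with hN
  have hout : (((univ : Finset ι).powersetCard n).filter fun S => ¬ k ∈ S)
      = (univ.erase k).powersetCard n := by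
    ext S
    simp only [mem_filter, mem_powersetCard, subset_univ, true_and, subset_erase]
    tauto
  have hcout : #(((univ : Finset ι).powersetCard n).filter fun S => ¬ k ∈ S)
      = (N - 1).choose n := by
    rw [hout, card_powersetCard, card_erase_of_mem (mem_univ k), card_univ]
  have hcin : #(((univ : Finset ι).powersetCard n).filter fun S => k ∈ S) + (N - 1).choose n
      = N.choose n := by
    rw [← hcout, card_filter_add_card_filter_not, card_powersetCard, card_univ]
  have hN1 : 1 ≤ N := by omega
  have hmul : (N - 1).choose n * N = N.choose n * (N - n) := by
    have := Nat.choose_mul_succ_eq (N - 1) n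
    rwa [Nat.sub_add_cancel hN1] at this
  have hC : (0 : ℝ) < N.choose n := by exact_mod_cast Nat.choose_pos hn.le
  have hNpos : (0 : ℝ) < N := by exact_mod_cast hN1
  have hmul' : ((N - 1).choose n : ℝ) = N.choose n * ((N : ℝ) - n) / N := by
    rw [eq_div_iff hNpos.ne', ← Nat.cast_sub hn.le]
    exact_mod_cast hmul
  have hcin' : (#(((univ : Finset ι).powersetCard n).filter fun S => k ∈ S) : ℝ)
      = N.choose n * n / N := by
    have : (#(((univ : Finset ι).powersetCard n).filter fun S => k ∈ S) : ℝ)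
      + ((N - 1).choose n : ℝ) = N.choose n := by exact_mod_cast hcin
    rw [eq_sub_of_add_eq this, hmul']
    field_simp
    ring
  have hsplit : ∀ S ∈ (univ : Finset ι).powersetCard n,
      (1 / (N.choose n : ℝ)) / (if k ∈ S then r else q)
        = if k ∈ S then (1 / (N.choose n : ℝ)) / r else (1 / (N.choose n : ℝ)) / q := by
    intro S _
    split_ifs <;> rfl
  have hden : 0 < (n : ℝ) * q + ((N : ℝ) - n) * r := by
    have : (n : ℝ) < N := by exact_mod_cast hn
    have : 0 < ((N : ℝ) - n) * r := mul_pos (by linarith) hr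
    positivity
  rw [sum_congr rfl hsplit, sum_ite, sum_const, sum_const, nsmul_eq_mul, nsmul_eq_mul, hcout,
    hmul', hcin']
  field_simp

/-! ### Points and signs as a common index set -/

/-- The weight on `Fin M ⊕ (Fin M → Bool)` which is the counting measure on the points. -/
noncomputable def pointWeight {M : ℕ} : Fin M ⊕ (Fin M → Bool) → ℝ≥0 :=
  Sum.elim (fun _ => 1) fun _ => 0

/-- The weight on `Fin M ⊕ (Fin M → Bool)` which is the uniform distribution on the signs. -/
noncomputable def signWeight {M : ℕ} : Fin M ⊕ (Fin M → Bool) → ℝ≥0 :=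
  Sum.elim (fun _ => 0) fun _ => (2 ^ M)⁻¹

/-- The coefficients of the linear combinations attached to a point or a choice of signs. -/
noncomputable def indexCoeff (𝕜 : Type*) [RCLike 𝕜] {M : ℕ} :
    Fin M ⊕ (Fin M → Bool) → Fin M → 𝕜 :=
  Sum.elim (fun i₀ i => if i = i₀ then 1 else 0) fun ε i => ((boolSign (ε i) : ℝ) : 𝕜)

theorem norm_indexCoeff_le {𝕜 : Type*} [RCLike 𝕜] {M : ℕ} (ω : Fin M ⊕ (Fin M → Bool))
    (i : Fin M) : ‖indexCoeff 𝕜 ω i‖ ≤ 1 := by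
  rcases ω with i₀ | ε
  · simp only [indexCoeff, Sum.elim_inl]
    split_ifs <;> simp
  · simp [indexCoeff, abs_boolSign]

theorem sum_signWeight (M : ℕ) : ∑ ω : Fin M ⊕ (Fin M → Bool), signWeight ω = 1 := by
  simp [signWeight]

/-- With this weight the average is exactly an ℓ_r sum, so coordinates in S cost the constant 1.
Since points and signs share one index type, only the weight depends on S. -/
theorem sum_pointWeight_mul {Y : Type*} [NormedAddCommGroup Y] {𝕜 : Type*} [RCLike 𝕜]
    [NormedSpace 𝕜 Y] {M : ℕ} {r : ℝ} (v : Fin M → Y) :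
    ∑ ω, pointWeight ω * ‖∑ i, indexCoeff 𝕜 ω i • v i‖₊ ^ r = ∑ i, ‖v i‖₊ ^ r := by
  simp [pointWeight, indexCoeff]

theorem sum_nnnorm_rpow_le_constA {𝕜 : Type*} [RCLike 𝕜] {q r : ℝ} {Y : Type v}
    [NormedAddCommGroup Y] [NormedSpace 𝕜 Y] [CompleteSpace Y] (hY : HasCotype 𝕜 q Y)
    (hr : 1 ≤ r) {M : ℕ} (v : Fin M → Y) :
    (∑ i, ‖v i‖₊ ^ q) ^ (1 / q) ≤ (constA 𝕜 q r Y).toNNReal *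
      (∑ ω, signWeight ω * ‖∑ i, indexCoeff 𝕜 ω i • v i‖₊ ^ r) ^ (1 / r) := by
  have h := cotype_le_constA hY hr v
  rw [rademacherNorm_eq] at h
  rw [← NNReal.coe_le_coe]
  push_cast
  rw [Real.coe_toNNReal _ (constA_nonneg 𝕜 q r Y)]
  refine h.trans (le_of_eq ?_)
  simp [signWeight, indexCoeff, mul_sum]

theorem sum_prod_pointWeight_mul {τ : Type*} [Fintype τ] [DecidableEq τ] {M : ℕ}
    (F : (τ → Fin M ⊕ (Fin M → Bool)) → ℝ) :
    ∑ α : τ → Fin M ⊕ (Fin M → Bool), ((∏ k, pointWeight (α k) : ℝ≥0) : ℝ) * F α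
      = ∑ i : τ → Fin M, F fun k => Sum.inl (i k) := by
  symm
  refine Fintype.sum_of_injective (fun (i : τ → Fin M) k => Sum.inl (i k)) ?_ _ _ ?_ ?_
  · intro i j hij
    funext k
    exact Sum.inl_injective (congrFun hij k)
  · intro α hα
    by_cases h : ∀ k, ∃ i, α k = Sum.inl i
    · choose i hi using h
      exact (hα ⟨i, funext fun k => (hi k).symm⟩).elim
    · push Not at h
      obtain ⟨k, hk⟩ := h
      have : pointWeight (α k) = 0 := by
        rcases hα' : α k with i | ε
        · exact (hk i hα').elim
        · rfl
      rw [prod_eq_zero (mem_univ k) this]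
      simp
  · intro i
    simp [pointWeight]

/-! ### The summing inequality for multilinear operators -/

section Main

variable {𝕜 : Type*} [RCLike 𝕜] {ι : Type*} [Fintype ι] [DecidableEq ι]
  {X : ι → Type u} [∀ k, NormedAddCommGroup (X k)] [∀ k, NormedSpace 𝕜 (X k)]
  {Y : Type v} [NormedAddCommGroup Y] [NormedSpace 𝕜 Y]

/-- The average over the signs in the coordinates outside `S` of the `ℓ_r` sums over the
coordinates in `S`. -/
theorem randomized_sum_le {r : ℝ} (hr : 0 < r) {U : ContinuousMultilinearMap 𝕜 X Y} {S : Finset ι}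
    (hS : IsMultipleSummingIn r U S) (hb : PartialBounded r U S) {M : ℕ} (x : ∀ k, Fin M → X k) :
    (∑ ω : ι → Fin M ⊕ (Fin M → Bool),
      ((∏ k, (if k ∈ S then pointWeight else signWeight) (ω k) : ℝ≥0) : ℝ) *
        ‖∑ j : ι → Fin M, (∏ k, indexCoeff 𝕜 (ω k) (j k)) • U fun k => x k (j k)‖ ^ r) ^ (1 / r)
      ≤ partialNorm r U S * ∏ k, weakL1Norm 𝕜 (x k) := by
  set u : ∀ k, Fin M ⊕ (Fin M → Bool) → X k := fun k ω => ∑ i, indexCoeff 𝕜 ω i • x k i with hu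
  have hlin : ∀ ω : ι → Fin M ⊕ (Fin M → Bool),
      ∑ j : ι → Fin M, (∏ k, indexCoeff 𝕜 (ω k) (j k)) • U (fun k => x k (j k))
        = U fun k => u k (ω k) := by
    intro ω
    rw [hu, ContinuousMultilinearMap.map_sum]
    exact sum_congr rfl fun j _ => (ContinuousMultilinearMap.map_smul_univ U _ _).symm
  have hunorm : ∀ k ω, ‖u k ω‖ ≤ weakL1Norm 𝕜 (x k) := fun k ω =>
    norm_sum_smul_le_weakL1Norm _ _ fun i => norm_indexCoeff_le ω i
  set B : ℝ := partialNorm r U S * ∏ k, weakL1Norm 𝕜 (x k) with hB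
  have hB0 : 0 ≤ B := mul_nonneg (partialNorm_nonneg _ _ _) (prod_weakL1Norm_nonneg x)
  set Φ : ({k // ¬ k ∈ S} → Fin M ⊕ (Fin M → Bool)) →
      ContinuousMultilinearMap 𝕜 (fun k : {k // k ∈ S} => X k) Y :=
    fun β => partialMap U S fun k => u k (β k) with hΦ
  -- The fixed vectors have norm at most the weak ℓ_1 norms, so the bound is uniform in `β` and
  -- survives averaging with total mass 1.
  have hinner : ∀ β, ∑ i : {k // k ∈ S} → Fin M, ‖Φ β fun k => x k (i k)‖ ^ r ≤ B ^ r := by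
    intro β
    have h1 := (hS fun k => u k (β k)).sum_le fun k : {k // k ∈ S} => x k
    have h2 : summingNorm r (Φ β) * ∏ k : {k // k ∈ S}, weakL1Norm 𝕜 (x k) ≤ B := by
      rw [hB, ← prod_mem_mul_prod_not_mem S, mul_comm (∏ _, _),
        ← mul_assoc]
      refine mul_le_mul_of_nonneg_right ((hb.summingNorm_le _).trans
        (mul_le_mul_of_nonneg_left ?_ (partialNorm_nonneg _ _ _)))
        (prod_nonneg fun _ _ => weakL1Norm_nonneg _)
      exact prod_le_prod (fun _ _ => norm_nonneg _) fun k _ => hunorm k _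
    have h3 := Real.rpow_le_rpow (Real.rpow_nonneg (sum_nonneg fun _ _ =>
      Real.rpow_nonneg (norm_nonneg _) _) _) (h1.trans h2) hr.le
    rwa [← Real.rpow_mul (sum_nonneg fun _ _ => Real.rpow_nonneg (norm_nonneg _) _),
      one_div_mul_cancel hr.ne', Real.rpow_one] at h3
  have hsum : ∑ ω : ι → Fin M ⊕ (Fin M → Bool),
      ((∏ k, (if k ∈ S then pointWeight else signWeight) (ω k) : ℝ≥0) : ℝ) *
        ‖∑ j : ι → Fin M, (∏ k, indexCoeff 𝕜 (ω k) (j k)) • U fun k => x k (j k)‖ ^ r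
      = ∑ β : {k // ¬ k ∈ S} → Fin M ⊕ (Fin M → Bool),
        ((∏ k, signWeight (β k) : ℝ≥0) : ℝ) *
          ∑ i : {k // k ∈ S} → Fin M, ‖Φ β fun k => x k (i k)‖ ^ r := by
    rw [← (Equiv.piEquivPiSubtypeProd (fun k => k ∈ S)
      fun _ => Fin M ⊕ (Fin M → Bool)).symm.sum_comp, Fintype.sum_prod_type_right]
    refine sum_congr rfl fun β _ => ?_
    have hx : ∀ i : {k // k ∈ S} → Fin M,
        (fun k : {k // k ∈ S} => x k (i k)) = fun k : {k // k ∈ S} => u k (Sum.inl (i k)) := by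
      intro i
      funext k
      simp [hu, indexCoeff]
    simp only [hx]
    rw [← sum_prod_pointWeight_mul fun α => ‖Φ β fun k => u k (α k)‖ ^ r, mul_sum]
    refine sum_congr rfl fun α _ => ?_
    rw [hlin, ← prod_mem_mul_prod_not_mem S, ← mul_assoc]
    congr 1
    · rw [mul_comm, NNReal.coe_mul]
      congr 2
      · refine prod_congr rfl fun k _ => ?_
        simp [k.2]
      · refine prod_congr rfl fun k _ => ?_
        simp [k.2]
    · congr 2
      refine congrArg U (funext fun k => ?_)
      by_cases hk : k ∈ S <;> simp [hk]
  rw [hsum]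
  have htotal : ∑ β : {k // ¬ k ∈ S} → Fin M ⊕ (Fin M → Bool),
      ((∏ k, signWeight (β k) : ℝ≥0) : ℝ) = 1 := by
    rw [← NNReal.coe_sum, ← Fintype.piFinset_univ,
      ← prod_univ_sum (fun _ => univ) fun _ ω => signWeight ω,
      prod_congr rfl fun _ _ => sum_signWeight M, prod_const_one, NNReal.coe_one]
  calc _ ≤ (∑ β : {k // ¬ k ∈ S} → Fin M ⊕ (Fin M → Bool),
        ((∏ k, signWeight (β k) : ℝ≥0) : ℝ) * B ^ r) ^ (1 / r) := by
        refine Real.rpow_le_rpow (sum_nonneg fun β _ => mul_nonneg (NNReal.coe_nonneg _)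
          (sum_nonneg fun _ _ => Real.rpow_nonneg (norm_nonneg _) _))
          (sum_le_sum fun β _ => ?_) (by positivity)
        exact mul_le_mul_of_nonneg_left (hinner β) (NNReal.coe_nonneg _)
    _ = B := by
        rw [← sum_mul, htotal, one_mul, ← Real.rpow_mul hB0, mul_one_div_cancel hr.ne',
          Real.rpow_one]

/-- The case in which all coordinates are used. -/
theorem IsSeparatelySumming.isMultipleSumming [∀ k, CompleteSpace (X k)] [CompleteSpace Y]
    {q r ρ : ℝ} (hY : HasCotype 𝕜 q Y) (hr : 1 ≤ r) (hrq : r ≤ q) {n : ℕ}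
    (hn : n < Fintype.card ι) {U : ContinuousMultilinearMap 𝕜 X Y}
    (hU : IsSeparatelySumming n r U)
    (hρ : ρ = q * r * Fintype.card ι / (n * q + ((Fintype.card ι : ℝ) - n) * r)) :
    IsMultipleSumming ρ U ∧
      (∀ S ∈ (univ : Finset ι).powersetCard n, PartialBounded r U S) ∧
      summingNorm ρ U ≤ constA 𝕜 q r Y ^ (Fintype.card ι - n) *
        ∏ S ∈ (univ : Finset ι).powersetCard n,
          partialNorm r U S ^ (1 / ((Fintype.card ι).choose n : ℝ)) := by
  set N := Fintype.card ι with hN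
  have hr0 : 0 < r := by linarith
  have hq0 : 0 < q := by linarith
  have hnN : (n : ℝ) < N := by exact_mod_cast hn
  have hNpos : (0 : ℝ) < N := (Nat.cast_nonneg n).trans_lt hnN
  have hρ0 : 0 < ρ := by
    have : 0 < ((N : ℝ) - n) * r := mul_pos (by linarith) hr0
    rw [hρ]
    positivity
  have hC : (0 : ℝ) < N.choose n := by exact_mod_cast Nat.choose_pos hn.le
  have hsum : ∀ S ∈ (univ : Finset ι).powersetCard n, IsMultipleSummingIn r U S := fun S hS =>
    hU S (mem_powersetCard.1 hS).2
  have hbdd : ∀ S ∈ (univ : Finset ι).powersetCard n, PartialBounded r U S := fun S hS =>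
    (hsum S hS).partialBounded hr
  have hA := constA_nonneg 𝕜 q r Y
  have hprod : 0 ≤ ∏ S ∈ (univ : Finset ι).powersetCard n,
      partialNorm r U S ^ (1 / (N.choose n : ℝ)) :=
    prod_nonneg fun S _ => Real.rpow_nonneg (partialNorm_nonneg _ _ _) _
  have key := isMultipleSumming_and_summingNorm_le (r := ρ) (U := U)
    (mul_nonneg (pow_nonneg hA (N - n)) hprod) fun M x => ?_
  · exact ⟨key.1, hbdd, key.2⟩
  -- Exponent r and constant 1 on S, exponent q and constant A off S, with the same interpolation
  -- weight for every S.
  have h1 := sum_nnnorm_rpow_le_prod (𝕜 := 𝕜) hr0 hρ0 ((univ : Finset ι).powersetCard n)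
    (fun _ => 1 / (N.choose n : ℝ)) (fun _ _ => by positivity)
    (by rw [sum_const, card_powersetCard, card_univ, nsmul_eq_mul, ← hN]; field_simp)
    (fun S k => if k ∈ S then r else q)
    (fun S _ k => by split_ifs <;> linarith)
    (fun k => by rw [hρ]; exact sum_powersetCard_div hq0 hr0 hn k)
    (fun S k => if k ∈ S then 1 else (constA 𝕜 q r Y).toNNReal)
    (fun S k => if k ∈ S then pointWeight else signWeight) (indexCoeff 𝕜 (M := M))
    (fun S _ k v => by
      split_ifs with hk
      · rw [one_mul, sum_pointWeight_mul]
      · exact sum_nnnorm_rpow_le_constA hY hr v)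
    fun j => U fun k => x k (j k)
  rw [← NNReal.coe_le_coe] at h1
  push_cast at h1
  refine h1.trans ?_
  have hW := prod_weakL1Norm_nonneg (𝕜 := 𝕜) x
  calc _ ≤ ∏ S ∈ (univ : Finset ι).powersetCard n, (constA 𝕜 q r Y ^ (N - n) *
        (partialNorm r U S * ∏ k, weakL1Norm 𝕜 (x k))) ^ (1 / (N.choose n : ℝ)) := by
        refine prod_le_prod (fun S _ => by positivity) fun S hS => ?_
        have hcard : ∏ k, ((if k ∈ S then 1 else (constA 𝕜 q r Y).toNNReal : ℝ≥0) : ℝ)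
            = constA 𝕜 q r Y ^ (N - n) := by
          rw [← NNReal.coe_prod, prod_ite, prod_const_one, one_mul, prod_const, filter_not,
            filter_mem_eq_inter, univ_inter, ← compl_eq_univ_sdiff, card_compl,
            (mem_powersetCard.1 hS).2, NNReal.coe_pow, Real.coe_toNNReal _ hA]
        rw [hcard]
        refine Real.rpow_le_rpow (by positivity) (mul_le_mul_of_nonneg_left ?_ (by positivity))
          (by positivity)
        have := randomized_sum_le hr0 (hsum S hS) (hbdd S hS) x
        push_cast at this
        exact this
    _ = (∏ S ∈ (univ : Finset ι).powersetCard n,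
          (constA 𝕜 q r Y ^ (N - n) * ∏ k, weakL1Norm 𝕜 (x k)) ^ (1 / (N.choose n : ℝ))) *
        ∏ S ∈ (univ : Finset ι).powersetCard n,
          partialNorm r U S ^ (1 / (N.choose n : ℝ)) := by
        rw [← prod_mul_distrib]
        refine prod_congr rfl fun S _ => ?_
        rw [← Real.mul_rpow (by positivity) (partialNorm_nonneg _ _ _)]
        congr 1
        ring
    -- The factor independent of S occurs binom(N, n) times with exponent 1 / binom(N, n), hence
    -- once.
    _ = _ := by
        rw [prod_const, card_powersetCard, card_univ, ← hN, ← Real.rpow_natCast,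
          ← Real.rpow_mul (by positivity), one_div_mul_cancel hC.ne', Real.rpow_one]
        ring

omit [Fintype ι] in
/-- Fixing coordinates preserves separate summability. -/
theorem IsSeparatelySumming.partialMap {n : ℕ} {r : ℝ} {U : ContinuousMultilinearMap 𝕜 X Y}
    (hU : IsSeparatelySumming n r U) (D : Finset ι) (x : ∀ k : {k // ¬ k ∈ D}, X k) :
    IsSeparatelySumming n r (partialMap U D x) := by
  intro S hS z
  let S' : Finset ι := S.map (Function.Embedding.subtype _)
  have hS' : ∀ k : {k // k ∈ D}, k.1 ∈ S' ↔ k ∈ S := fun k => by simp [S']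
  have hD : ∀ k ∈ S', k ∈ D := fun k hk => by
    obtain ⟨k', -, rfl⟩ := mem_map.1 hk
    exact k'.2
  -- Outside `S'` the coordinates come from `z` within D and from `x` beyond D.
  let z' : ∀ k : {k // ¬ k ∈ S'}, X k := fun k =>
    if h : k.1 ∈ D then z ⟨⟨k.1, h⟩, fun h' => k.2 ((hS' ⟨k.1, h⟩).2 h')⟩ else x ⟨k.1, h⟩
  let e : {k : {k // k ∈ D} // k ∈ S} ≃ {k // k ∈ S'} :=
    { toFun := fun k => ⟨k.1.1, (hS' k.1).2 k.2⟩
      invFun := fun k => ⟨⟨k.1, hD k.1 k.2⟩, (hS' ⟨k.1, hD k.1 k.2⟩).1 k.2⟩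
      left_inv := fun _ => rfl
      right_inv := fun _ => rfl }
  obtain ⟨C, hC0, hC⟩ := hU S' ((card_map _).trans hS) z'
  refine ⟨C, hC0, fun M a => ?_⟩
  have h := hC M fun k => a (e.symm k)
  rw [← (e.arrowCongr (Equiv.refl (Fin M))).sum_comp,
    ← e.prod_comp fun k => weakL1Norm 𝕜 (a (e.symm k))] at h
  refine le_trans (le_of_eq ?_) h
  congr 1
  refine sum_congr rfl fun i _ => ?_
  congr 2
  refine congrArg U (funext fun k => ?_)
  by_cases hk : k ∈ D
  · by_cases hk' : (⟨k, hk⟩ : {k // k ∈ D}) ∈ S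
    · have := (hS' ⟨k, hk⟩).2 hk'
      simp [hk, hk', this, e]
    · have : ¬ k ∈ S' := fun h => hk' ((hS' ⟨k, hk⟩).1 h)
      simp [hk, hk', this, z']
  · have : ¬ k ∈ S' := fun h => hk (hD k h)
    simp [hk, this, z']

end Main

end MultipleSumming

open MultipleSumming in
theorem mainTheorem1 {𝕜 : Type*} [RCLike 𝕜] {m : ℕ}
    {X : Fin m → Type u} [∀ k, NormedAddCommGroup (X k)] [∀ k, NormedSpace 𝕜 (X k)]
    [∀ k, CompleteSpace (X k)]
    {Y : Type v} [NormedAddCommGroup Y] [NormedSpace 𝕜 Y] [CompleteSpace Y]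
    (q r : ℝ) (hq : 2 ≤ q) (hY : HasCotype 𝕜 q Y) (hr : 1 ≤ r) (hrq : r ≤ q)
    (n : ℕ) (hn : 1 ≤ n) (hnm : n < m)
    (U : ContinuousMultilinearMap 𝕜 X Y) (hU : IsSeparatelySumming n r U)
    (N : ℕ) (hnN : n < N) (hNm : N ≤ m)
    (rN : ℝ) (hrN : rN = q * r * N / (n * q + ((N : ℝ) - n) * r)) :
    IsSeparatelySumming N rN U ∧
    (N < m → ∀ D : Finset (Fin m), D.card = N → ∀ x : (∀ k : {k // ¬ k ∈ D}, X k),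
      (∀ S ∈ (Finset.univ : Finset {k // k ∈ D}).powersetCard n,
        PartialBounded r (partialMap U D x) S) ∧
      summingNorm rN (partialMap U D x) ≤
        constA 𝕜 q r Y ^ (N - n) *
          ∏ S ∈ (Finset.univ : Finset {k // k ∈ D}).powersetCard n,
            partialNorm r (partialMap U D x) S ^ (1 / (N.choose n : ℝ))) ∧
    (N = m →
      IsMultipleSumming rN U ∧
      (∀ S ∈ (Finset.univ : Finset (Fin m)).powersetCard n, PartialBounded r U S) ∧
      summingNorm rN U ≤
        constA 𝕜 q r Y ^ (m - n) *
          ∏ S ∈ (Finset.univ : Finset (Fin m)).powersetCard n,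
            partialNorm r U S ^ (1 / (m.choose n : ℝ))) := by
  have hpart : ∀ D : Finset (Fin m), D.card = N → ∀ x : (∀ k : {k // ¬ k ∈ D}, X k),
      IsMultipleSumming rN (partialMap U D x) ∧
      (∀ S ∈ (Finset.univ : Finset {k // k ∈ D}).powersetCard n,
        PartialBounded r (partialMap U D x) S) ∧
      summingNorm rN (partialMap U D x) ≤
        constA 𝕜 q r Y ^ (N - n) *
          ∏ S ∈ (Finset.univ : Finset {k // k ∈ D}).powersetCard n,
            partialNorm r (partialMap U D x) S ^ (1 / (N.choose n : ℝ)) := by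
    intro D hD x
    have hcard : Fintype.card {k // k ∈ D} = N := (Fintype.card_coe D).trans hD
    have h := (hU.partialMap D x).isMultipleSumming (ρ := rN) hY hr hrq (hcard ▸ hnN)
      (by rw [hcard]; exact hrN)
    rwa [hcard] at h
  refine ⟨fun D hD x => (hpart D hD x).1, fun _ D hD x => (hpart D hD x).2, fun hN => ?_⟩
  subst hN
  -- For N = m the conclusion concerns U itself rather than its restriction to the full set of
  -- coordinates, so the general case is applied directly.
  have h := hU.isMultipleSumming (ρ := rN) hY hr hrq (by rwa [Fintype.card_fin])
    (by rw [Fintype.card_fin]; exact hrN)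
  rwa [Fintype.card_fin] at h
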